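/- Let $k$ be an algebraically closed field and let $\mathcal{A}$ be a balanced braided category in $\mathsf{Lex}^{\mathsf f}$. That is, $\mathcal{A}$ is a $k$-linear abelian category with finite-dimensional morphism spaces, enough projectives, finitely many simple objects up to isomorphism and all objects of finite length, together with a $k$-bilinear monoidal product $\otimes$ (with unit $I$) that is left exact in each variable, a braiding $c$, and a balancing, i.e. a natural automorphism $\theta$ of $\mathrm{id}_{\mathcal{A}}$ with $\theta_I=\mathrm{id}_I$ and $\theta_{X\otimes Y}=c_{Y,X}c_{X,Y}(\theta_X\otimes\theta_Y)$. A ribbon Grothendieck–Verdier structure on $\mathcal{A}$ consists of an object $K$, an equivalence $D:\mathcal{A}\to\mathcal{A}^{\mathrm{opp}}$ and $k$-linear isomorphisms $\mathcal{A}(DX,Y)\cong\mathcal{A}(K,X\otimes Y)$ natural in $X,Y$, such that $\theta_{DX}=D\theta_X$ for all $X$. Write $\kappa(X,Y)=\mathcal{A}(DX,Y)$ for its pairing and $\gamma:\kappa(I,X\otimes Y)\cong\kappa(X,Y)$ for the induced isomorphism. Let $\mathsf{AUT}(\mathcal{A})$ be the 2-group of $k$-linear braided monoidal autoequivalences $\varphi$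 of $\mathcal{A}$ with $\varphi(\theta_X)=\theta_{\varphi X}$, and monoidal natural isomorphisms between them. Let $B\mathsf{AUT}(\mathcal{A})$ be the corresponding 2-groupoid with a single object. Let $\mathsf{RIBGV}(\mathcal{A})$ be the 2-groupoid whose objects are the ribbon Grothendieck–Verdier structures on $\mathcal{A}$; whose 1-morphisms from a structure with pairing $\kappa_1$ to a structure with pairing $\kappa_2$ are pairs $(\varphi,t)$ of an object $\varphi$ of $\mathsf{AUT}(\mathcal{A})$ and a $k$-linear natural isomorphism $t:\kappa_1(X,Y)\cong\kappa_2(\varphi X,\varphi Y)$ compatible with the isomorphisms $\gamma_1,\gamma_2$; and whose 2-morphisms are the monoidal natural isomorphisms compatible with the isomorphisms $t$. The space of ribbon Grothendieck–Verdier extensions relative to $\mathcal{A}$ is the homotopy fiber, over the base point, of the forgetful map $q:\mathsf{RIBGV}(\mathcal{A})\to B\mathsf{AUT}(\mathcal{A})$ of 2-groupoids. Let $Z_2^{\mathsf{bal}}(\mathcal{A})\subset\mathcal{A}$ be the balanced Müger center: the full monoidal subcategory of all $X$ with $c_{Y,X}c_{X,Y}=\mathrm{id}_{X\otimes Y}$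 for all $Y\in\mathcal{A}$ and $\theta_X=\mathrm{id}_X$. Let $\mathsf{PIC}(Z_2^{\mathsf{bal}}(\mathcal{A}))$ be the groupoid of its invertible objects and the isomorphisms between them. Then the space of ribbon Grothendieck–Verdier extensions relative to $\mathcal{A}$ is either empty or equivalent to the classifying space $B\,\mathsf{PIC}(Z_2^{\mathsf{bal}}(\mathcal{A}))$ of this groupoid. Here spaces are modelled by 2-groupoids: in the second case, the homotopy fiber of $q$ is biequivalent to the groupoid $\mathsf{PIC}(Z_2^{\mathsf{bal}}(\mathcal{A}))$, regarded as a 2-groupoid with only identity 2-morphisms. -/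

import Mathlib

universe w w' v v' u u'

namespace RibGV

open CategoryTheory Category

/-! ### Bicategorical generalities -/

section Bicat

open Bicategory

variable {B : Type u} [Bicategory.{w, v} B] {C : Type u'} [Bicategory.{w', v'} C]

/-- Objects of the homotopy fiber of a pseudofunctor `q` over `c`: an object `b` of the source
together with a 1-morphism `q b ⟶ c`. This is used for 2-groupoids (all 1-morphisms are
equivalences, all 2-morphisms are invertible), where it is the standard homotopy fiber. -/
structure HFiber (q : Pseudofunctor B C) (c : C) where
  /-- the object of the source -/
  pt : B
  /-- the path from its image to the base point -/
  path : q.obj pt ⟶ c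

namespace HFiber

variable {q : Pseudofunctor B C} {c : C}

/-- 1-morphisms of the homotopy fiber: a 1-morphism of the source with an invertible
2-morphism filling the resulting triangle over `c`. -/
structure Hom₁ (x y : HFiber q c) where
  /-- the 1-morphism of the source -/
  map : x.pt ⟶ y.pt
  /-- the filler of the triangle -/
  fill : q.map map ≫ y.path ≅ x.path

/-- 2-morphisms of the homotopy fiber: 2-morphisms of the source compatible with the fillers. -/
@[ext]
structure Hom₂ {x y : HFiber q c} (f g : Hom₁ x y) where
  /-- the 2-morphism of the source -/
  cell : f.map ⟶ g.map
  comm : q.map₂ cell ▷ y.path ≫ g.fill.hom = f.fill.hom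

instance (x y : HFiber q c) : Category (Hom₁ x y) where
  Hom f g := Hom₂ f g
  id f := ⟨𝟙 _, by simp⟩
  comp a b := ⟨a.cell ≫ b.cell, by simp [b.comm, a.comm]⟩
  id_comp _ := Hom₂.ext (Category.id_comp _)
  comp_id _ := Hom₂.ext (Category.comp_id _)
  assoc _ _ _ := Hom₂.ext (Category.assoc _ _ _)

@[ext]
theorem hom₂_ext {x y : HFiber q c} {f g : Hom₁ x y} {a b : f ⟶ g} (h : a.cell = b.cell) :
    a = b := Hom₂.ext h

@[simp]
theorem id_cell {x y : HFiber q c} (f : Hom₁ x y) : Hom₂.cell (𝟙 f) = 𝟙 f.map := rfl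

@[simp]
theorem comp_cell {x y : HFiber q c} {f g h : Hom₁ x y} (a : f ⟶ g) (b : g ⟶ h) :
    Hom₂.cell (a ≫ b) = a.cell ≫ b.cell := rfl

/-- An invertible 2-morphism of the source which is compatible with the fillers gives an
invertible 2-morphism of the homotopy fiber. -/
def isoMk {x y : HFiber q c} {f g : Hom₁ x y} (e : f.map ≅ g.map)
    (h : q.map₂ e.hom ▷ y.path ≫ g.fill.hom = f.fill.hom) : f ≅ g where
  hom := ⟨e.hom, h⟩
  inv := ⟨e.inv, by
    rw [← h, ← Bicategory.comp_whiskerRight_assoc, ← PrelaxFunctor.map₂_comp]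
    simp⟩
  hom_inv_id := Hom₂.ext e.hom_inv_id
  inv_hom_id := Hom₂.ext e.inv_hom_id

@[simp]
theorem isoMk_hom_cell {x y : HFiber q c} {f g : Hom₁ x y} (e : f.map ≅ g.map)
    (h : q.map₂ e.hom ▷ y.path ≫ g.fill.hom = f.fill.hom) :
    (isoMk e h).hom.cell = e.hom := rfl

@[simp]
theorem isoMk_inv_cell {x y : HFiber q c} {f g : Hom₁ x y} (e : f.map ≅ g.map)
    (h : q.map₂ e.hom ▷ y.path ≫ g.fill.hom = f.fill.hom) :
    (isoMk e h).inv.cell = e.inv := rfl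

/-- The identity 1-morphism. -/
def id₁ (x : HFiber q c) : Hom₁ x x where
  map := 𝟙 x.pt
  fill := whiskerRightIso (q.mapId x.pt) x.path ≪≫ λ_ x.path

/-- Composition of 1-morphisms. -/
def comp₁ {x y z : HFiber q c} (f : Hom₁ x y) (g : Hom₁ y z) : Hom₁ x z where
  map := f.map ≫ g.map
  fill := whiskerRightIso (q.mapComp f.map g.map) z.path ≪≫ α_ _ _ _ ≪≫
    whiskerLeftIso (q.map f.map) g.fill ≪≫ f.fill

/-- Left whiskering. -/
def whiskerL {x y z : HFiber q c} (f : Hom₁ x y) {g h : Hom₁ y z} (a : g ⟶ h) :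
    comp₁ f g ⟶ comp₁ f h :=
  Hom₂.mk (f.map ◁ Hom₂.cell a) (by
    have := Hom₂.comm a
    simp only [comp₁, Iso.trans_hom, whiskerRightIso_hom, whiskerLeftIso_hom, ← this]
    simp)

/-- Right whiskering. -/
def whiskerR {x y z : HFiber q c} {f g : Hom₁ x y} (a : f ⟶ g) (h : Hom₁ y z) :
    comp₁ f h ⟶ comp₁ g h :=
  Hom₂.mk (Hom₂.cell a ▷ h.map) (by
    have := Hom₂.comm a
    simp only [comp₁, Iso.trans_hom, whiskerRightIso_hom, whiskerLeftIso_hom, ← this]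
    simp [whisker_exchange_assoc])

/-- The associator. -/
def assoc₁ {x y z t : HFiber q c} (f : Hom₁ x y) (g : Hom₁ y z) (h : Hom₁ z t) :
    comp₁ (comp₁ f g) h ≅ comp₁ f (comp₁ g h) :=
  isoMk (α_ f.map g.map h.map) (by simp [comp₁, whisker_exchange_assoc])

/-- The left unitor. -/
def left₁ {x y : HFiber q c} (f : Hom₁ x y) : comp₁ (id₁ x) f ≅ f :=
  isoMk (λ_ f.map) (by simp [comp₁, id₁, whisker_exchange_assoc])

/-- The right unitor. -/
def right₁ {x y : HFiber q c} (f : Hom₁ x y) : comp₁ f (id₁ y) ≅ f :=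
  isoMk (ρ_ f.map) (by simp [comp₁, id₁])

/-- The homotopy fiber as a bicategory. All of its structure is that of the source. -/
instance : Bicategory (HFiber q c) where
  Hom x y := Hom₁ x y
  id x := id₁ x
  comp f g := comp₁ f g
  whiskerLeft f _ _ a := whiskerL f a
  whiskerRight a h := whiskerR a h
  associator f g h := assoc₁ f g h
  leftUnitor f := left₁ f
  rightUnitor f := right₁ f
  whiskerLeft_id f g := Hom₂.ext (Bicategory.whiskerLeft_id f.map g.map)
  whiskerLeft_comp f _ _ _ a b := Hom₂.ext (Bicategory.whiskerLeft_comp f.map (Hom₂.cell a) (Hom₂.cell b))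
  id_whiskerLeft a := Hom₂.ext (Bicategory.id_whiskerLeft (Hom₂.cell a))
  comp_whiskerLeft f g _ _ a := Hom₂.ext (Bicategory.comp_whiskerLeft f.map g.map (Hom₂.cell a))
  id_whiskerRight f g := Hom₂.ext (Bicategory.id_whiskerRight f.map g.map)
  comp_whiskerRight a b h := Hom₂.ext (Bicategory.comp_whiskerRight (Hom₂.cell a) (Hom₂.cell b) h.map)
  whiskerRight_id a := Hom₂.ext (Bicategory.whiskerRight_id (Hom₂.cell a))
  whiskerRight_comp a g h := Hom₂.ext (Bicategory.whiskerRight_comp (Hom₂.cell a) g.map h.map)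
  whisker_assoc f _ _ a h := Hom₂.ext (Bicategory.whisker_assoc f.map (Hom₂.cell a) h.map)
  whisker_exchange a b := Hom₂.ext (Bicategory.whisker_exchange (Hom₂.cell a) (Hom₂.cell b))
  pentagon f g h i := Hom₂.ext (Bicategory.pentagon f.map g.map h.map i.map)
  triangle f g := Hom₂.ext (Bicategory.triangle f.map g.map)

end HFiber

/-- A pseudofunctor is a biequivalence if it is an equivalence on all hom categories and
surjective on objects up to equivalence. -/
structure IsBiequivalence (F : Pseudofunctor B C) : Prop where
  locally_equivalence : ∀ a b : B, (F.mapFunctor a b).IsEquivalence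
  essentially_surjective : ∀ c : C, ∃ b : B, Nonempty (Bicategory.Equivalence (F.obj b) c)

end Bicat

/-! ### Balanced braided categories in `Lex^f` -/

section Categories

open MonoidalCategory Limits

/-- A finite `k`-linear category: a `k`-linear abelian category with finite-dimensional morphism
spaces, enough projectives, finitely many simple objects up to isomorphism, and such that every
object has finite length (i.e. is both noetherian and artinian). -/
class FiniteLinearCategory (k : Type w) [Field k] (A : Type u) [Category.{v} A] [Abelian A]
    [Linear k A] : Prop where
  finiteDimensional_hom : ∀ X Y : A, Module.Finite k (X ⟶ Y)
  enoughProjectives : EnoughProjectives A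
  finite_simples : ∃ (n : ℕ) (S : Fin n → A), ∀ X : A, Simple X → ∃ i, Nonempty (X ≅ S i)
  finite_length : ∀ X : A, IsNoetherianObject X ∧ IsArtinianObject X

/-- The monoidal product is left exact in each variable. For a bilinear monoidal product on a
finite linear category this says that it is a 1-morphism `A ⊠ A ⟶ A` of `Lex^f`. -/
class LeftExactTensor (A : Type u) [Category.{v} A] [MonoidalCategory A] : Prop where
  left : ∀ X : A, PreservesFiniteLimits (tensorLeft X)
  right : ∀ X : A, PreservesFiniteLimits (tensorRight X)

/-- A balancing on a braided monoidal category. -/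
class Balancing (A : Type u) [Category.{v} A] [MonoidalCategory A] [BraidedCategory A] where
  /-- the natural automorphism of the identity functor -/
  twist : 𝟭 A ≅ 𝟭 A
  twist_unit : twist.hom.app (𝟙_ A) = 𝟙 (𝟙_ A)
  twist_tensor : ∀ X Y : A, twist.hom.app (X ⊗ Y) =
    (twist.hom.app X ⊗ₘ twist.hom.app Y) ≫ (β_ X Y).hom ≫ (β_ Y X).hom

/-- The component at `X` of the balancing. -/
def θ {A : Type u} [Category.{v} A] [MonoidalCategory A] [BraidedCategory A] [Balancing A]
    (X : A) : X ⟶ X :=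
  (Balancing.twist (A := A)).hom.app X

/-- The object `X` is invertible with respect to the monoidal product. -/
def isInvertible (A : Type u) [Category.{v} A] [MonoidalCategory A] : ObjectProperty A :=
  fun X => ∃ Y : A, Nonempty (X ⊗ Y ≅ 𝟙_ A) ∧ Nonempty (Y ⊗ X ≅ 𝟙_ A)

/-- The Picard groupoid of a monoidal category: the invertible objects and the isomorphisms
between them. -/
abbrev PIC (A : Type u) [Category.{v} A] [MonoidalCategory A] : Type u :=
  Core (isInvertible A).FullSubcategory

/-- The objects that trivially double braid with every object; they span the Müger center. -/
def isTransparent (A : Type u) [Category.{v} A] [MonoidalCategory A] [BraidedCategory A] :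
    ObjectProperty A :=
  fun X => ∀ Y : A, (β_ X Y).hom ≫ (β_ Y X).hom = 𝟙 (X ⊗ Y)

/-- The transparent objects with trivial balancing. -/
def isBalTransparent (A : Type u) [Category.{v} A] [MonoidalCategory A] [BraidedCategory A]
    [Balancing A] : ObjectProperty A :=
  fun X => isTransparent A X ∧ θ X = 𝟙 X

instance (A : Type u) [Category.{v} A] [MonoidalCategory A] [BraidedCategory A]
    [Balancing A] : (isBalTransparent A).IsMonoidal where
  prop_unit := ⟨fun Y => by simp, Balancing.twist_unit⟩
  prop_tensor X Y hX hY := by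
    refine ⟨fun Z => ?_, ?_⟩
    · have h1 := hX.1 Z
      have h2 := hY.1 Z
      rw [BraidedCategory.braiding_tensor_left_hom, BraidedCategory.braiding_tensor_right_hom]
      simp only [assoc, Iso.hom_inv_id_assoc]
      rw [← comp_whiskerRight_assoc, h1]
      simp only [id_whiskerRight, id_comp, Iso.inv_hom_id_assoc]
      rw [← MonoidalCategory.whiskerLeft_comp_assoc, h2]
      simp
    · have h := Balancing.twist_tensor X Y
      have h1 := hX.2
      have h2 := hY.2
      simp only [θ] at h1 h2 ⊢
      rw [h, h1, h2]
      simpa using hX.1 Y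

/-- The balanced Müger center: the full (monoidal) subcategory of transparent objects with
trivial balancing. -/
abbrev BalMugerCenter (A : Type u) [Category.{v} A] [MonoidalCategory A] [BraidedCategory A]
    [Balancing A] : Type u :=
  (isBalTransparent A).FullSubcategory

end Categories

/-! ### The 2-group of balanced braided autoequivalences -/

section Aut

open MonoidalCategory

section

variable {C : Type u} [Category.{v} C] [MonoidalCategory C]
  {F G H : C ⥤ C} [F.LaxMonoidal] [G.LaxMonoidal] [H.LaxMonoidal]

theorem assoc_isMonoidal : NatTrans.IsMonoidal (Functor.associator F G H).hom := inferInstance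

theorem left_isMonoidal : NatTrans.IsMonoidal F.leftUnitor.hom := inferInstance

theorem right_isMonoidal : NatTrans.IsMonoidal F.rightUnitor.hom := inferInstance

theorem whiskerLeft_isMonoidal (b : G ⟶ H) [NatTrans.IsMonoidal b] :
    NatTrans.IsMonoidal (Functor.whiskerLeft F b) := inferInstance

theorem whiskerRight_isMonoidal (b : G ⟶ H) [NatTrans.IsMonoidal b] :
    NatTrans.IsMonoidal (Functor.whiskerRight b F) := inferInstance

end

/-- A balanced braided autoequivalence of `A` in `Lex^f`: a `k`-linear braided monoidal
autoequivalence preserving the balancing. (An equivalence is automatically left exact.) -/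
structure AUT (k : Type w) [Field k] (A : Type u) [Category.{v} A] [Preadditive A] [Linear k A]
    [MonoidalCategory A] [BraidedCategory A] [Balancing A] where
  /-- the underlying functor -/
  functor : A ⥤ A
  /-- its braided monoidal structure -/
  [braided : functor.Braided]
  [additive : functor.Additive]
  [linear : functor.Linear k]
  [isEquivalence : functor.IsEquivalence]
  map_twist : ∀ X : A, functor.map (θ X) = θ (functor.obj X)

namespace AUT

attribute [instance] AUT.braided AUT.additive AUT.linear AUT.isEquivalence

variable {k : Type w} [Field k] {A : Type u} [Category.{v} A] [Preadditive A] [Linear k A]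
    [MonoidalCategory A] [BraidedCategory A] [Balancing A]

/-- Morphisms of balanced braided autoequivalences: monoidal natural isomorphisms. -/
@[ext]
structure Hom (F G : AUT k A) where
  /-- the underlying natural transformation -/
  nat : F.functor ⟶ G.functor
  isIso : IsIso nat
  isMonoidal : NatTrans.IsMonoidal nat

attribute [instance] Hom.isIso Hom.isMonoidal

instance : Category (AUT k A) where
  Hom F G := Hom F G
  id F := ⟨𝟙 F.functor, inferInstance, inferInstance⟩
  comp a b := ⟨a.nat ≫ b.nat, inferInstance, inferInstance⟩
  id_comp _ := Hom.ext (Category.id_comp _)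
  comp_id _ := Hom.ext (Category.comp_id _)
  assoc _ _ _ := Hom.ext (Category.assoc _ _ _)

/-- The natural transformation underlying a morphism of balanced braided autoequivalences. -/
abbrev nat {F G : AUT k A} (a : F ⟶ G) : F.functor ⟶ G.functor := Hom.nat a

theorem hom_ext {F G : AUT k A} {a b : F ⟶ G} (h : ∀ X, (nat a).app X = (nat b).app X) :
    a = b := Hom.ext (NatTrans.ext (funext h))

@[simp]
theorem id_app (F : AUT k A) (X : A) : (nat (𝟙 F)).app X = 𝟙 (F.functor.obj X) := rfl

@[simp]
theorem comp_app {F G H : AUT k A} (a : F ⟶ G) (b : G ⟶ H) (X : A) :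
    (nat (a ≫ b)).app X = (nat a).app X ≫ (nat b).app X := rfl

/-- A monoidal natural isomorphism as an isomorphism of balanced braided autoequivalences. -/
def isoMk {F G : AUT k A} (e : F.functor ≅ G.functor) (h : NatTrans.IsMonoidal e.hom) : F ≅ G where
  hom := ⟨e.hom, inferInstance, inferInstance⟩
  inv := ⟨e.inv, inferInstance, inferInstance⟩
  hom_inv_id := Hom.ext e.hom_inv_id
  inv_hom_id := Hom.ext e.inv_hom_id

variable (k A) in
/-- The identity autoequivalence. -/
def one : AUT k A where
  functor := 𝟭 A
  map_twist _ := rfl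

/-- Composition of autoequivalences (first `F`, then `G`). -/
def comp (F G : AUT k A) : AUT k A where
  functor := F.functor ⋙ G.functor
  map_twist X := by
    simp only [Functor.comp_map, F.map_twist, G.map_twist, Functor.comp_obj]

/-- The 2-group of balanced braided autoequivalences, as a monoidal category under
composition. -/
instance : MonoidalCategoryStruct (AUT k A) where
  tensorObj F G := comp F G
  tensorUnit := one k A
  whiskerLeft F _ _ b :=
    haveI := b.isIso
    haveI := b.isMonoidal
    ⟨Functor.whiskerLeft F.functor b.nat,
      inferInstanceAs (IsIso (Functor.whiskerLeft F.functor b.nat)),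
      whiskerLeft_isMonoidal b.nat⟩
  whiskerRight a G :=
    haveI := a.isIso
    haveI := a.isMonoidal
    ⟨Functor.whiskerRight a.nat G.functor,
      inferInstanceAs (IsIso (Functor.whiskerRight a.nat G.functor)),
      whiskerRight_isMonoidal a.nat⟩
  associator F G H := isoMk (F := comp (comp F G) H) (G := comp F (comp G H))
    (Functor.associator F.functor G.functor H.functor) assoc_isMonoidal
  leftUnitor F := isoMk (F := comp (one k A) F) F.functor.leftUnitor left_isMonoidal
  rightUnitor F := isoMk (F := comp F (one k A)) F.functor.rightUnitor right_isMonoidal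

section

variable {F F' G G' H : AUT k A}

@[simp]
theorem whiskerLeft_app (F : AUT k A) (b : G ⟶ H) (X : A) :
    (nat (F ◁ b)).app X = (nat b).app (F.functor.obj X) := rfl

@[simp]
theorem whiskerRight_app (a : F ⟶ G) (H : AUT k A) (X : A) :
    (nat (a ▷ H)).app X = H.functor.map ((nat a).app X) := rfl

@[simp]
theorem tensorHom_app (a : F ⟶ F') (b : G ⟶ G') (X : A) :
    (nat (a ⊗ₘ b)).app X = G.functor.map ((nat a).app X) ≫ (nat b).app (F'.functor.obj X) := rfl

@[simp]
theorem associator_hom_app (X : A) : (nat (α_ F G H).hom).app X = 𝟙 _ := rfl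

@[simp]
theorem leftUnitor_hom_app (X : A) : (nat (λ_ F).hom).app X = 𝟙 _ := rfl

@[simp]
theorem rightUnitor_hom_app (X : A) : (nat (ρ_ F).hom).app X = 𝟙 _ := rfl

@[simp]
theorem tensorObj_functor : (F ⊗ G).functor = F.functor ⋙ G.functor := rfl

@[simp]
theorem tensorUnit_functor : (𝟙_ (AUT k A)).functor = 𝟭 A := rfl

end

instance : MonoidalCategory (AUT k A) where
  tensorHom_def _ _ := rfl
  id_tensorHom_id _ _ := hom_ext fun X => by simp
  tensorHom_comp_tensorHom _ _ _ _ := hom_ext fun X => by simp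
  whiskerLeft_id _ _ := hom_ext fun X => by simp
  id_whiskerRight _ _ := hom_ext fun X => by simp
  associator_naturality _ _ _ := hom_ext fun X => by simp [← Functor.map_comp]
  leftUnitor_naturality _ := hom_ext fun X => by simp
  rightUnitor_naturality _ := hom_ext fun X => by simp
  pentagon _ _ _ _ := hom_ext fun X => by simp
  triangle _ _ := hom_ext fun X => by simp

/-- The classifying space of the 2-group of balanced braided autoequivalences: the 2-groupoid
with a single object whose 1-morphisms are the balanced braided autoequivalences. -/
abbrev B (k : Type w) [Field k] (A : Type u) [Category.{v} A] [Preadditive A] [Linear k A]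
    [MonoidalCategory A] [BraidedCategory A] [Balancing A] : Type :=
  MonoidalSingleObj (AUT k A)

end AUT

end Aut

/-! ### Ribbon Grothendieck–Verdier structures -/

section GV

open MonoidalCategory Opposite

/-- A Grothendieck–Verdier structure on a `k`-linear monoidal category `A` (left exact
convention): a dualizing object `K` such that `A(K, X ⊗ -)` is represented by `D X` for every
`X` and such that the resulting functor `D : A ⥤ Aᵒᵖ` is an equivalence. -/
structure GVStructure (k : Type w) [Field k] (A : Type u) [Category.{v} A] [Preadditive A]
    [Linear k A] [MonoidalCategory A] where
  /-- the dualizing object -/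
  K : A
  /-- the duality functor -/
  D : A ⥤ Aᵒᵖ
  /-- the isomorphisms `A(D X, Y) ≅ A(K, X ⊗ Y)` -/
  rep (X Y : A) : ((D.obj X).unop ⟶ Y) ≃ₗ[k] (K ⟶ X ⊗ Y)
  rep_comp {X Y Y' : A} (h : (D.obj X).unop ⟶ Y) (g : Y ⟶ Y') :
    rep X Y' (h ≫ g) = rep X Y h ≫ X ◁ g
  rep_map {X X' Y : A} (f : X ⟶ X') (h : (D.obj X).unop ⟶ Y) :
    rep X' Y ((D.map f).unop ≫ h) = rep X Y h ≫ f ▷ Y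
  isEquivalence : D.IsEquivalence

/-- A ribbon Grothendieck–Verdier structure on a balanced braided category:
a Grothendieck–Verdier structure with `θ_{D X} = D θ_X`. -/
structure RibbonGVStructure (k : Type w) [Field k] (A : Type u) [Category.{v} A] [Preadditive A]
    [Linear k A] [MonoidalCategory A] [BraidedCategory A] [Balancing A]
    extends GVStructure k A where
  dual_twist : ∀ X : A, (D.map (θ X)).unop = θ (D.obj X).unop

namespace GVStructure

variable {k : Type w} [Field k] {A : Type u} [Category.{v} A] [Preadditive A]
    [Linear k A] [MonoidalCategory A]

/-- The pairing `κ(X, Y) = A(D X, Y)`. -/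
abbrev κ (R : GVStructure k A) (X Y : A) : Type v := (R.D.obj X).unop ⟶ Y

/-- Functoriality of the pairing in both variables. -/
def κMap (R : GVStructure k A) {X X' Y Y' : A} (f : X ⟶ X') (g : Y ⟶ Y') (h : R.κ X Y) :
    R.κ X' Y' :=
  (R.D.map f).unop ≫ h ≫ g

/-- The isomorphism `γ : κ(I, X ⊗ Y) ≅ κ(X, Y)` of the Grothendieck–Verdier structure, i.e.
`A(D I, X ⊗ Y) ≅ A(K, I ⊗ (X ⊗ Y)) ≅ A(K, X ⊗ Y) ≅ A(D X, Y)`. -/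
def γ (R : GVStructure k A) (X Y : A) (h : R.κ (𝟙_ A) (X ⊗ Y)) : R.κ X Y :=
  (R.rep X Y).symm (R.rep (𝟙_ A) (X ⊗ Y) h ≫ (λ_ (X ⊗ Y)).hom)

theorem κMap_id (R : GVStructure k A) {X Y : A} (h : R.κ X Y) : R.κMap (𝟙 X) (𝟙 Y) h = h := by
  simp [κMap]

theorem κMap_comp (R : GVStructure k A) {X X' X'' Y Y' Y'' : A} (f : X ⟶ X') (f' : X' ⟶ X'')
    (g : Y ⟶ Y') (g' : Y' ⟶ Y'') (h : R.κ X Y) :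
    R.κMap (f ≫ f') (g ≫ g') h = R.κMap f' g' (R.κMap f g h) := by
  simp [κMap]

end GVStructure

namespace RibbonGVStructure

variable {k : Type w} [Field k] {A : Type u} [Category.{v} A] [Preadditive A]
    [Linear k A] [MonoidalCategory A] [BraidedCategory A] [Balancing A]

open Functor.OplaxMonoidal in
/-- A cyclic balanced braided autoequivalence of `A` between ribbon Grothendieck–Verdier
structures `R` and `S`: a balanced braided autoequivalence `φ` together with a natural
isomorphism `t : κ_R(X, Y) ≅ κ_S(φ X, φ Y)` compatible with the isomorphisms `γ`. -/
structure Hom₁ (R S : RibbonGVStructure k A) where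
  /-- the underlying balanced braided autoequivalence -/
  φ : AUT k A
  /-- the preservation of the pairing -/
  t (X Y : A) : R.κ X Y ≃ₗ[k] S.κ (φ.functor.obj X) (φ.functor.obj Y)
  t_natural {X X' Y Y' : A} (f : X ⟶ X') (g : Y ⟶ Y') (h : R.κ X Y) :
    t X' Y' (R.κMap f g h) = S.κMap (φ.functor.map f) (φ.functor.map g) (t X Y h)
  t_γ (X Y : A) (h : R.κ (𝟙_ A) (X ⊗ Y)) :
    t X Y (R.γ X Y h) = S.γ (φ.functor.obj X) (φ.functor.obj Y)
      (S.κMap (η φ.functor) (δ φ.functor X Y) (t (𝟙_ A) (X ⊗ Y) h))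

/-- 2-morphisms: morphisms of balanced braided autoequivalences compatible with the
preservation of the pairings. -/
@[ext]
structure Hom₂ {R S : RibbonGVStructure k A} (f g : Hom₁ R S) where
  /-- the underlying monoidal natural isomorphism -/
  cell : f.φ ⟶ g.φ
  comm (X Y : A) (h : R.κ X Y) :
    S.κMap ((AUT.nat cell).app X) ((AUT.nat cell).app Y) (f.t X Y h) = g.t X Y h

instance (R S : RibbonGVStructure k A) : Category (Hom₁ R S) where
  Hom f g := Hom₂ f g
  id f := ⟨𝟙 _, fun X Y h => by simp [GVStructure.κMap_id]⟩
  comp a b := ⟨a.cell ≫ b.cell, fun X Y h => by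
    simp [GVStructure.κMap_comp, a.comm, b.comm]⟩
  id_comp _ := Hom₂.ext (Category.id_comp _)
  comp_id _ := Hom₂.ext (Category.comp_id _)
  assoc _ _ _ := Hom₂.ext (Category.assoc _ _ _)

/-- The identity 1-morphism. -/
def id₁ (R : RibbonGVStructure k A) : Hom₁ R R where
  φ := 𝟙_ (AUT k A)
  t X Y := LinearEquiv.refl k (R.κ X Y)
  t_natural _ _ _ := rfl
  t_γ X Y h := congrArg (R.γ X Y) (R.κMap_id h).symm

/-- Composition of 1-morphisms. -/
def comp₁ {R S T : RibbonGVStructure k A} (f : Hom₁ R S) (g : Hom₁ S T) : Hom₁ R T where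
  φ := f.φ ⊗ g.φ
  t X Y := (f.t X Y).trans (g.t (f.φ.functor.obj X) (f.φ.functor.obj Y))
  t_natural a b h :=
    (congrArg (g.t _ _) (f.t_natural a b h)).trans (g.t_natural _ _ _)
  t_γ X Y h :=
    ((congrArg (g.t _ _) (f.t_γ X Y h)).trans (g.t_γ _ _ _)).trans <|
      congrArg (T.γ _ _) <| (congrArg (T.κMap _ _) (g.t_natural _ _ _)).trans
        (T.κMap_comp _ _ _ _ _).symm

/-- An isomorphism of balanced braided autoequivalences compatible with the preservation of the
pairings is an isomorphism of 1-morphisms. -/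
def isoMk {R S : RibbonGVStructure k A} {f g : Hom₁ R S} (e : f.φ ≅ g.φ)
    (w : ∀ (X Y : A) (h : R.κ X Y), S.κMap ((AUT.nat e.hom).app X) ((AUT.nat e.hom).app Y)
      (f.t X Y h) = g.t X Y h) : f ≅ g where
  hom := ⟨e.hom, w⟩
  inv := ⟨e.inv, fun X Y h => by
    have hX : (AUT.nat e.hom).app X ≫ (AUT.nat e.inv).app X = 𝟙 _ := by
      rw [← AUT.comp_app, e.hom_inv_id, AUT.id_app]
    have hY : (AUT.nat e.hom).app Y ≫ (AUT.nat e.inv).app Y = 𝟙 _ := by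
      rw [← AUT.comp_app, e.hom_inv_id, AUT.id_app]
    rw [← w, ← GVStructure.κMap_comp, hX, hY, GVStructure.κMap_id]⟩
  hom_inv_id := Hom₂.ext e.hom_inv_id
  inv_hom_id := Hom₂.ext e.inv_hom_id

/-- Left whiskering. -/
def whiskerL {R S T : RibbonGVStructure k A} (f : Hom₁ R S) {g h : Hom₁ S T} (a : g ⟶ h) :
    comp₁ f g ⟶ comp₁ f h :=
  Hom₂.mk (f.φ ◁ Hom₂.cell a) fun _ _ _ => Hom₂.comm a _ _ _

/-- Right whiskering. -/
def whiskerR {R S T : RibbonGVStructure k A} {f g : Hom₁ R S} (a : f ⟶ g) (h : Hom₁ S T) :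
    comp₁ f h ⟶ comp₁ g h :=
  Hom₂.mk (Hom₂.cell a ▷ h.φ) fun X Y p =>
    (h.t_natural _ _ _).symm.trans (congrArg (h.t _ _) (Hom₂.comm a X Y p))

end RibbonGVStructure

/-- The 2-groupoid of ribbon Grothendieck–Verdier categories whose underlying balanced braided
category is `A`. Its objects are the ribbon Grothendieck–Verdier structures on `A`, its
1-morphisms the cyclic balanced braided autoequivalences, and its 2-morphisms the compatible
monoidal natural isomorphisms. -/
abbrev RIBGV (k : Type w) [Field k] (A : Type u) [Category.{v} A] [Preadditive A]
    [Linear k A] [MonoidalCategory A] [BraidedCategory A] [Balancing A] : Type (max u v) :=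
  RibbonGVStructure k A

namespace RIBGV

open RibbonGVStructure

variable {k : Type w} [Field k] {A : Type u} [Category.{v} A] [Preadditive A]
    [Linear k A] [MonoidalCategory A] [BraidedCategory A] [Balancing A]

instance : Bicategory (RIBGV k A) where
  Hom R S := Hom₁ R S
  id R := id₁ R
  comp f g := comp₁ f g
  whiskerLeft f _ _ a := whiskerL f a
  whiskerRight a h := whiskerR a h
  associator {_ _ _ S} f g h := isoMk (f := comp₁ (comp₁ f g) h) (g := comp₁ f (comp₁ g h))
    (α_ f.φ g.φ h.φ) (fun _ _ _ => S.κMap_id _)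
  leftUnitor {_ S} f := isoMk (f := comp₁ (id₁ _) f) (λ_ f.φ) (fun _ _ _ => S.κMap_id _)
  rightUnitor {_ S} f := isoMk (f := comp₁ f (id₁ _)) (ρ_ f.φ) (fun _ _ _ => S.κMap_id _)
  whiskerLeft_id f g := Hom₂.ext (MonoidalCategory.whiskerLeft_id f.φ g.φ)
  whiskerLeft_comp f _ _ _ a b :=
    Hom₂.ext (MonoidalCategory.whiskerLeft_comp f.φ (Hom₂.cell a) (Hom₂.cell b))
  id_whiskerLeft a := Hom₂.ext (MonoidalCategory.id_whiskerLeft (Hom₂.cell a))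
  comp_whiskerLeft f g _ _ a :=
    Hom₂.ext (MonoidalCategory.tensor_whiskerLeft f.φ g.φ (Hom₂.cell a))
  id_whiskerRight f g := Hom₂.ext (MonoidalCategory.id_whiskerRight f.φ g.φ)
  comp_whiskerRight a b h :=
    Hom₂.ext (MonoidalCategory.comp_whiskerRight (Hom₂.cell a) (Hom₂.cell b) h.φ)
  whiskerRight_id a := Hom₂.ext (MonoidalCategory.whiskerRight_id (Hom₂.cell a))
  whiskerRight_comp a g h :=
    Hom₂.ext (MonoidalCategory.whiskerRight_tensor (Hom₂.cell a) g.φ h.φ)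
  whisker_assoc f _ _ a h := Hom₂.ext (MonoidalCategory.whisker_assoc f.φ (Hom₂.cell a) h.φ)
  whisker_exchange a b :=
    Hom₂.ext (MonoidalCategory.whisker_exchange (Hom₂.cell a) (Hom₂.cell b))
  pentagon f g h i := Hom₂.ext (MonoidalCategory.pentagon f.φ g.φ h.φ i.φ)
  triangle f g := Hom₂.ext (MonoidalCategory.triangle f.φ g.φ)

/-- The forgetful map `q : RIBGV(A) ⟶ B AUT(A)`. -/
def q (k : Type w) [Field k] (A : Type u) [Category.{v} A] [Preadditive A]
    [Linear k A] [MonoidalCategory A] [BraidedCategory A] [Balancing A] :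
    Pseudofunctor (RIBGV k A) (AUT.B k A) where
  obj _ := MonoidalSingleObj.star (AUT k A)
  map f := Hom₁.φ f
  map₂ a := Hom₂.cell a
  map₂_id _ := rfl
  map₂_comp _ _ := rfl
  mapId _ := Iso.refl (𝟙_ (AUT k A))
  mapComp f g := Iso.refl (Hom₁.φ f ⊗ Hom₁.φ g)
  map₂_whisker_left f _ _ a := show f.φ ◁ Hom₂.cell a = 𝟙 _ ≫ f.φ ◁ Hom₂.cell a ≫ 𝟙 _ by simp
  map₂_whisker_right a h := show Hom₂.cell a ▷ h.φ = 𝟙 _ ≫ Hom₂.cell a ▷ h.φ ≫ 𝟙 _ by simp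
  map₂_associator f g h :=
    show (α_ f.φ g.φ h.φ).hom = 𝟙 _ ≫ 𝟙 (f.φ ⊗ g.φ) ▷ h.φ ≫ (α_ f.φ g.φ h.φ).hom ≫
      f.φ ◁ 𝟙 (g.φ ⊗ h.φ) ≫ 𝟙 _ by simp
  map₂_left_unitor f :=
    show (λ_ f.φ).hom = 𝟙 _ ≫ 𝟙 (𝟙_ (AUT k A)) ▷ f.φ ≫ (λ_ f.φ).hom by simp
  map₂_right_unitor f :=
    show (ρ_ f.φ).hom = 𝟙 _ ≫ f.φ ◁ 𝟙 (𝟙_ (AUT k A)) ≫ (ρ_ f.φ).hom by simp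

end RIBGV

/-- The space (2-groupoid) of ribbon Grothendieck–Verdier extensions relative to `A`: the
homotopy fiber of `q : RIBGV(A) ⟶ B AUT(A)` over the base point. -/
abbrev RibbonGVExtensions (k : Type w) [Field k] (A : Type u) [Category.{v} A] [Preadditive A]
    [Linear k A] [MonoidalCategory A] [BraidedCategory A] [Balancing A] : Type (max u v) :=
  HFiber (RIBGV.q k A) (MonoidalSingleObj.star (AUT k A))

end GV

end RibGV

namespace RibGV

open CategoryTheory Category MonoidalCategory Opposite

/-! ### Pairings, the unit element and the shifted representation. -/

section Pairing

variable {k : Type w} [Field k] {A : Type u} [Category.{v} A] [Preadditive A]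
    [Linear k A] [MonoidalCategory A]

namespace GVStructure

variable (R : GVStructure k A)

/-! A cyclic structure `t` on a balanced braided autoequivalence `φ`, going from `R` to `S`, amounts
to an isomorphism `K_S ≅ φ K_R`. Indeed every element of `κ(X, Y)` comes from one universal element
of `κ(I, K)` by functoriality and `γ`, a Yoneda argument, so compatibility with `γ` determines `t`
from its value there (`Hom₁.rep_t`, `Hom₁.isIso_kMap`); conversely `Hom₁.ofIso` builds `t` from any
isomorphism. Compatibility of 2-morphisms reduces in the same way to the dualizing objects.

Now fix one structure `R` with duality `D`. An invertible `L` in the balanced Müger center gives the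
structure with dualizing object `D L` and duality `D (L ⊗ -)`, and an isomorphism `L ≅ M` gives `D M
≅ D L`. In the homotopy fiber a 1-morphism between two such shifts carries a trivialization of its
autoequivalence, so only an isomorphism `D M ≅ D L` remains, and this is `D` of a unique isomorphism
`L ≅ M`. The trivializations also leave at most one 2-morphism between parallel 1-morphisms. This
gives the equivalence on hom categories.

For essential surjectivity, let `(S, G)` be a point of the fiber and choose `L` with `D L ≅ G K_S`.
Comparing represented functors gives `D (L ⊗ G X) ≅ G (D_S X)`. Since both dualities and `G` are
equivalences, so is `L ⊗ -`, hence `L` is invertible; since both structures are ribbon, `θ_{L ⊗ X} =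
L ◁ θ_X`, which characterizes the balanced Müger center (`isBalTransparent_iff`). Then `(S, G)` is
equivalent to the shift of `R` by `L`. -/

theorem rep_κMap {X X' Y Y' : A} (f : X ⟶ X') (g : Y ⟶ Y') (h : R.κ X Y) :
    R.rep X' Y' (R.κMap f g h) = R.rep X Y h ≫ (f ⊗ₘ g) := by
  rw [κMap, R.rep_map, R.rep_comp, assoc, tensorHom_def']

theorem rep_γ (X Y : A) (h : R.κ (𝟙_ A) (X ⊗ Y)) :
    R.rep X Y (R.γ X Y h) = R.rep (𝟙_ A) (X ⊗ Y) h ≫ (λ_ (X ⊗ Y)).hom := by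
  simp [γ]

/-- The element of `κ(I, K)` which corresponds to the identity of `K`. -/
def unitElement : R.κ (𝟙_ A) R.K := (R.rep (𝟙_ A) R.K).symm (λ_ R.K).inv

/-- Every element of the pairing is obtained from the unit element. -/
theorem eq_γ_unitElement {X Y : A} (h : R.κ X Y) :
    h = R.γ X Y (R.κMap (𝟙 _) (R.rep X Y h) R.unitElement) := by
  -- Under `rep`, `γ` becomes the left unitor and the unit element its inverse, so the two cancel.
  apply (R.rep X Y).injective
  rw [rep_γ, rep_κMap, unitElement, LinearEquiv.apply_symm_apply]
  simp

/-- The isomorphisms `A(D (L ⊗ X), Y) ≅ A(D L, X ⊗ Y)`. -/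
def shiftRep (L X Y : A) :
    ((R.D.obj (L ⊗ X)).unop ⟶ Y) ≃ₗ[k] ((R.D.obj L).unop ⟶ X ⊗ Y) :=
  (R.rep (L ⊗ X) Y).trans
    ((Linear.homCongr k (Iso.refl R.K) (α_ L X Y)).trans (R.rep L (X ⊗ Y)).symm)

theorem rep_shiftRep (L X Y : A) (h : (R.D.obj (L ⊗ X)).unop ⟶ Y) :
    R.rep L (X ⊗ Y) (R.shiftRep L X Y h) = R.rep (L ⊗ X) Y h ≫ (α_ L X Y).hom := by
  simp [shiftRep, Linear.homCongr_apply]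

theorem shiftRep_comp (L : A) {X Y Y' : A} (h : (R.D.obj (L ⊗ X)).unop ⟶ Y) (g : Y ⟶ Y') :
    R.shiftRep L X Y' (h ≫ g) = R.shiftRep L X Y h ≫ X ◁ g := by
  apply (R.rep _ _).injective
  simp [R.rep_comp, rep_shiftRep]

theorem shiftRep_map (L : A) {X X' Y : A} (f : X ⟶ X') (h : (R.D.obj (L ⊗ X)).unop ⟶ Y) :
    R.shiftRep L X' Y ((R.D.map (L ◁ f)).unop ≫ h) = R.shiftRep L X Y h ≫ f ▷ Y := by
  apply (R.rep _ _).injective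
  rw [rep_shiftRep, R.rep_map, R.rep_comp, rep_shiftRep]
  simp

end GVStructure

end Pairing

/-! ### Invertible objects and tensoring equivalences. -/

section Invertible

variable {A : Type u} [Category.{v} A] [MonoidalCategory A]

/-- Tensoring with an invertible object is an equivalence. -/
theorem isEquivalence_tensorLeft {L : A} (h : isInvertible A L) :
    (tensorLeft L).IsEquivalence := by
  obtain ⟨M, ⟨e⟩, ⟨e'⟩⟩ := h
  exact (CategoryTheory.Equivalence.mk (tensorLeft L) (tensorLeft M)
    ((leftUnitorNatIso A).symm ≪≫ (tensoringLeft A).mapIso e'.symm ≪≫ tensorLeftTensor M L)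
    ((tensorLeftTensor L M).symm ≪≫ (tensoringLeft A).mapIso e ≪≫
      leftUnitorNatIso A)).isEquivalence_functor

/-- In a braided category, an object is invertible if tensoring with it is an equivalence. -/
theorem isInvertible_of_isEquivalence [BraidedCategory A] {L : A}
    (h : (tensorLeft L).IsEquivalence) : isInvertible A L :=
  ⟨(tensorLeft L).objPreimage (𝟙_ A), ⟨(tensorLeft L).objObjPreimageIso (𝟙_ A)⟩,
    ⟨(β_ _ _) ≪≫ (tensorLeft L).objObjPreimageIso (𝟙_ A)⟩⟩

end Invertible

/-! ### The balanced Müger center through the balancing. -/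

section Balanced

variable {A : Type u} [Category.{v} A] [MonoidalCategory A] [BraidedCategory A] [Balancing A]

theorem θ_naturality {X Y : A} (f : X ⟶ Y) : f ≫ θ Y = θ X ≫ f :=
  (Balancing.twist (A := A)).hom.naturality f

theorem θ_tensor (X Y : A) :
    θ (X ⊗ Y) = (θ X ⊗ₘ θ Y) ≫ (β_ X Y).hom ≫ (β_ Y X).hom :=
  Balancing.twist_tensor X Y

theorem θ_unit : θ (𝟙_ A) = 𝟙 _ := Balancing.twist_unit

instance (X : A) : IsIso (θ X) := inferInstanceAs (IsIso ((Balancing.twist (A := A)).hom.app X))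

/-- An object lies in the balanced Müger center if and only if the balancing is linear with
respect to tensoring with it. -/
theorem isBalTransparent_iff (L : A) :
    isBalTransparent A L ↔ ∀ X : A, θ (L ⊗ X) = L ◁ θ X := by
  constructor
  · rintro ⟨h, h'⟩ X
    rw [θ_tensor, h', h X]
    simp
  · intro h
    -- Take `X = I`, where `θ` is trivial, and transport along the right unitor.
    have h' : θ L = 𝟙 L := by
      have := θ_naturality (ρ_ L).hom
      rw [h, θ_unit, MonoidalCategory.whiskerLeft_id, id_comp] at this
      rwa [← cancel_epi (ρ_ L).hom, comp_id]
    refine ⟨fun X => ?_, h'⟩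
    have := h X
    rw [θ_tensor, h', id_tensorHom] at this
    rwa [← cancel_epi (L ◁ θ X), comp_id]

/-- The balanced Müger center is closed under inverses. -/
theorem isBalTransparent_of_iso {L M : A} (hL : isInvertible A L) (h : isBalTransparent A L)
    (e : L ⊗ M ≅ 𝟙_ A) : isBalTransparent A M := by
  rw [isBalTransparent_iff] at h ⊢
  intro X
  have := isEquivalence_tensorLeft hL
  apply (tensorLeft L).map_injective
  -- Naturality of `θ` along `L ⊗ (M ⊗ X) ≅ X` compares `L ◁ θ_{M ⊗ X}` with `θ_X`, and `L ⊗ -` is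
  -- faithful.
  have h1 := θ_naturality ((α_ L M X).inv ≫ e.hom ▷ X ≫ (λ_ X).hom)
  rw [h] at h1
  change L ◁ _ = L ◁ _
  rw [← cancel_mono ((α_ L M X).inv ≫ e.hom ▷ X ≫ (λ_ X).hom), ← h1, assoc, assoc,
    associator_inv_naturality_right_assoc, whisker_exchange_assoc, leftUnitor_naturality]

/-- The invertible objects of the balanced Müger center are the invertible objects that lie in
the balanced Müger center. -/
def picMk (L : A) (hL : isInvertible A L) (h : isBalTransparent A L) : PIC (BalMugerCenter A) :=
  ⟨⟨L, h⟩, by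
    obtain ⟨M, ⟨e⟩, ⟨e'⟩⟩ := id hL
    exact ⟨⟨M, isBalTransparent_of_iso hL h e⟩,
      ⟨(isBalTransparent A).isoMk e⟩, ⟨(isBalTransparent A).isoMk e'⟩⟩⟩

theorem isInvertible_of_pic (L : PIC (BalMugerCenter A)) : isInvertible A L.of.obj.obj := by
  obtain ⟨M, ⟨e⟩, ⟨e'⟩⟩ := L.of.property
  exact ⟨M.obj, ⟨(isBalTransparent A).ι.mapIso e⟩, ⟨(isBalTransparent A).ι.mapIso e'⟩⟩

end Balanced

/-- A morphism is invertible if precomposition with it is bijective on the morphisms into the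
image of an essentially surjective functor. -/
theorem isIso_of_precomp_bijective {A : Type u} [Category.{v} A] {B : Type u'} [Category.{v'} B]
    (G : B ⥤ A) [G.EssSurj] {Z W : A} (a : Z ⟶ W)
    (h : ∀ Y : B, Function.Bijective fun w : W ⟶ G.obj Y => a ≫ w) : IsIso a := by
  have h' (Y : A) : Function.Bijective fun w : W ⟶ Y => a ≫ w := by
    let e := G.objObjPreimageIso Y
    refine ⟨fun w w' hw => ?_, fun z => ?_⟩
    · rw [← cancel_mono e.inv]
      apply (h _).1
      simpa using hw =≫ e.inv
    · obtain ⟨w, hw⟩ := (h _).2 (z ≫ e.inv)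
      exact ⟨w ≫ e.hom, by simpa using hw =≫ e.hom⟩
  -- Yoneda: surjectivity at `Z` gives `r` with `a ≫ r = 𝟙`, and injectivity at `W` then forces `r ≫
  -- a = 𝟙`.
  obtain ⟨r, hr⟩ := (h' Z).2 (𝟙 Z)
  exact ⟨r, hr, (h' W).1 (by simp only at hr ⊢; rw [reassoc_of% hr, comp_id])⟩

open Functor.OplaxMonoidal

/-! ### Cyclic structures as isomorphisms of dualizing objects. -/

section Cyclic

variable {k : Type w} [Field k] {A : Type u} [Category.{v} A] [Preadditive A]
    [Linear k A] [MonoidalCategory A] [BraidedCategory A] [Balancing A]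

/-- The isomorphism `κ_R(X, Y) ≅ κ_S(φ X, φ Y)` induced by an isomorphism `K_S ≅ φ K_R`. -/
noncomputable def pairingEquiv (R S : GVStructure k A) (φ : AUT k A)
    (e : S.K ≅ φ.functor.obj R.K) (X Y : A) :
    R.κ X Y ≃ₗ[k] S.κ (φ.functor.obj X) (φ.functor.obj Y) :=
  (R.rep X Y).trans <|
    (LinearEquiv.ofBijective (φ.functor.mapLinearMap k (X := R.K) (Y := X ⊗ Y))
      ((Functor.FullyFaithful.ofFullyFaithful φ.functor).map_bijective _ _)).trans <|
    (Linear.homCongr k e.symm (Functor.Monoidal.μIso φ.functor X Y).symm).trans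
    (S.rep _ _).symm

theorem rep_pairingEquiv (R S : GVStructure k A) (φ : AUT k A)
    (e : S.K ≅ φ.functor.obj R.K) {X Y : A} (h : R.κ X Y) :
    S.rep _ _ (pairingEquiv R S φ e X Y h) =
      e.hom ≫ φ.functor.map (R.rep X Y h) ≫ δ φ.functor X Y := by
  rw [pairingEquiv, LinearEquiv.trans_apply, LinearEquiv.trans_apply, LinearEquiv.trans_apply,
    LinearEquiv.apply_symm_apply, Linear.homCongr_apply]
  exact assoc _ _ _

namespace RibbonGVStructure

variable {R S T : RibbonGVStructure k A}

/-- An isomorphism `K_S ≅ φ K_R` of dualizing objects makes the balanced braided autoequivalence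
`φ` cyclic. -/
noncomputable def Hom₁.ofIso (φ : AUT k A) (e : S.K ≅ φ.functor.obj R.K) : Hom₁ R S where
  φ := φ
  t := pairingEquiv R.toGVStructure S.toGVStructure φ e
  t_natural f g h := by
    apply (S.rep _ _).injective
    rw [rep_pairingEquiv, S.rep_κMap, R.rep_κMap, rep_pairingEquiv]
    simp
  t_γ X Y h := by
    apply (S.rep _ _).injective
    rw [rep_pairingEquiv, S.rep_γ, R.rep_γ, S.rep_κMap, rep_pairingEquiv]
    simp only [MonoidalCategory.tensorHom_def, Functor.map_comp, assoc]
    rw [leftUnitor_naturality, left_unitality_hom_assoc]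

/-- The morphism `K_S ⟶ φ K_R` of dualizing objects underlying a cyclic balanced braided
autoequivalence. -/
def Hom₁.kMap (f : Hom₁ R S) : S.K ⟶ f.φ.functor.obj R.K :=
  S.rep _ _ (f.t _ _ R.unitElement) ≫ η f.φ.functor ▷ _ ≫ (λ_ _).hom

/-- A cyclic balanced braided autoequivalence is determined by the morphism of dualizing
objects. -/
theorem Hom₁.rep_t (f : Hom₁ R S) {X Y : A} (h : R.κ X Y) :
    S.rep _ _ (f.t X Y h) = f.kMap ≫ f.φ.functor.map (R.rep X Y h) ≫ δ f.φ.functor X Y := by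
  -- Since `h` comes from the unit element, `t_γ` and naturality express `t h` by the value of `t`
  -- on that element.
  conv_lhs => rw [R.eq_γ_unitElement h, f.t_γ, S.rep_γ, S.rep_κMap, f.t_natural, S.rep_κMap]
  rw [kMap, assoc, assoc, assoc, assoc, ← leftUnitor_naturality_assoc, ← leftUnitor_naturality,
    ← whisker_exchange_assoc, CategoryTheory.Functor.map_id, id_tensorHom,
    MonoidalCategory.tensorHom_def', whisker_exchange_assoc]
  simp only [assoc, whisker_exchange_assoc]

/-- Left unitality of `φ` cancels the unit constraints in the definition of `kMap`; this is how
`kMap` is computed below. -/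
theorem Hom₁.kMap_eq (f : Hom₁ R S) (a : S.K ⟶ f.φ.functor.obj R.K)
    (h : S.rep _ _ (f.t _ _ R.unitElement) =
      a ≫ f.φ.functor.map (λ_ R.K).inv ≫ δ f.φ.functor _ _) : f.kMap = a := by
  rw [kMap, h, assoc, assoc, left_unitality_hom, Iso.map_inv_hom_id, comp_id]

@[simp]
theorem Hom₁.kMap_ofIso (φ : AUT k A) (e : S.K ≅ φ.functor.obj R.K) :
    (Hom₁.ofIso (R := R) φ e).kMap = e.hom :=
  Hom₁.kMap_eq _ _ <| (rep_pairingEquiv _ _ _ _ _).trans <| by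
    rw [GVStructure.unitElement, LinearEquiv.apply_symm_apply]

/-- The order is reversed because `kMap` points from the dualizing object of the target to that of
the source. -/
theorem Hom₁.kMap_comp (f : Hom₁ R S) (g : Hom₁ S T) :
    (comp₁ f g).kMap = g.kMap ≫ g.φ.functor.map f.kMap :=
  have h : T.rep _ _ (g.t _ _ (f.t _ _ R.unitElement)) = (g.kMap ≫ g.φ.functor.map f.kMap) ≫
      g.φ.functor.map (f.φ.functor.map (λ_ R.K).inv) ≫
        g.φ.functor.map (δ f.φ.functor _ _) ≫ δ g.φ.functor _ _ := by
    rw [g.rep_t, f.rep_t, GVStructure.unitElement, LinearEquiv.apply_symm_apply]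
    simp only [Functor.map_comp, assoc]
  Hom₁.kMap_eq _ _ h

theorem Hom₁.kMap_id (R : RibbonGVStructure k A) : (id₁ R).kMap = 𝟙 R.K :=
  Hom₁.kMap_eq _ _ <| (LinearEquiv.apply_symm_apply _ _).trans <| by
    change _ = 𝟙 _ ≫ (λ_ R.K).inv ≫ 𝟙 _
    simp

/-- On `κ(I, Y)`, `rep_t` identifies `t` with precomposition by `kMap`, up to bijections. As `t` is
bijective and `φ` is essentially surjective, Yoneda applies. -/
instance Hom₁.isIso_kMap (f : Hom₁ R S) : IsIso f.kMap := by
  refine isIso_of_precomp_bijective f.φ.functor _ fun Y => ?_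
  have h1 : (fun w : f.φ.functor.obj R.K ⟶ f.φ.functor.obj Y => f.kMap ≫ w) ∘
      (f.φ.functor.map (X := R.K) (Y := Y)) ∘ (fun w => w ≫ (λ_ Y).hom) ∘ R.rep (𝟙_ A) Y =
      (fun w => w ≫ η f.φ.functor ▷ _ ≫ (λ_ _).hom) ∘ S.rep _ _ ∘ f.t (𝟙_ A) Y := by
    funext h
    simp only [Function.comp_apply, f.rep_t, assoc, left_unitality_hom, Functor.map_comp]
  have h2 {X Y Z : A} (a : Y ⟶ Z) [IsIso a] : Function.Bijective fun w : X ⟶ Y => w ≫ a :=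
    ⟨fun _ _ h => (cancel_mono a).1 h, fun w => ⟨w ≫ inv a, by simp⟩⟩
  rw [← Function.Bijective.of_comp_iff _ (((Functor.FullyFaithful.ofFullyFaithful
    f.φ.functor).map_bijective _ _).comp ((h2 (λ_ Y).hom).comp (R.rep _ _).bijective)), h1]
  exact (h2 (η f.φ.functor ▷ f.φ.functor.obj Y ≫ (λ_ _).hom)).comp
    ((S.rep _ _).bijective.comp (f.t _ _).bijective)

/-- A morphism of balanced braided autoequivalences is compatible with the pairings if it is
compatible with the morphisms of dualizing objects. -/
theorem comm_of_kMap {f g : Hom₁ R S} (a : f.φ ⟶ g.φ)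
    (h : f.kMap ≫ (AUT.nat a).app R.K = g.kMap) (X Y : A) (x : R.κ X Y) :
    S.κMap ((AUT.nat a).app X) ((AUT.nat a).app Y) (f.t X Y x) = g.t X Y x := by
  -- Monoidality is stated for `μ`; it passes to `δ`, its inverse.
  have ha : δ f.φ.functor X Y ≫ ((AUT.nat a).app X ⊗ₘ (AUT.nat a).app Y) =
      (AUT.nat a).app (X ⊗ Y) ≫ δ g.φ.functor X Y := by
    rw [← cancel_epi (Functor.LaxMonoidal.μ f.φ.functor X Y),
      ← cancel_mono (Functor.LaxMonoidal.μ g.φ.functor X Y)]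
    simp
  apply (S.rep _ _).injective
  rw [S.rep_κMap, f.rep_t, g.rep_t, ← h]
  simp [ha]

/-- The converse of `comm_of_kMap`: evaluate the compatibility with `t` on the unit element and use
that the transformation respects units. -/
theorem kMap_comm {f g : Hom₁ R S} (a : f ⟶ g) :
    f.kMap ≫ (AUT.nat (Hom₂.cell a)).app R.K = g.kMap := by
  have hu : (AUT.nat (Hom₂.cell a)).app (𝟙_ A) ≫ η g.φ.functor = η f.φ.functor := by
    rw [← cancel_epi (Functor.LaxMonoidal.ε f.φ.functor)]
    simp [reassoc_of% NatTrans.IsMonoidal.unit (τ := AUT.nat (Hom₂.cell a))]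
  rw [Hom₁.kMap, Hom₁.kMap, ← Hom₂.comm a, S.rep_κMap, assoc, assoc, assoc,
    MonoidalCategory.tensorHom_def', assoc, ← comp_whiskerRight_assoc, hu,
    ← leftUnitor_naturality, whisker_exchange_assoc]

/-- An isomorphism of balanced braided autoequivalences which is compatible with the morphisms
of dualizing objects. -/
def isoOfKMap {f g : Hom₁ R S} (e : f.φ ≅ g.φ)
    (h : f.kMap ≫ (AUT.nat e.hom).app R.K = g.kMap) : f ≅ g :=
  isoMk e (comm_of_kMap e.hom h)

end RibbonGVStructure

/-! ### Inverse autoequivalences. -/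

namespace AUT

/-- The inverse in an adjoint equivalence inherits all the structure, by checking each identity
after applying `G` and the counit. The triangle identity is recorded because the fillers in the
homotopy fiber require it. -/
theorem exists_inverse (G : AUT k A) : ∃ (H : AUT k A) (η : 𝟙_ (AUT k A) ≅ G ⊗ H)
    (ε : H ⊗ G ≅ 𝟙_ (AUT k A)), ∀ X, G.functor.map ((nat η.hom).app X) ≫
      (nat ε.hom).app (G.functor.obj X) = 𝟙 _ := by
  let e := G.functor.asEquivalence
  let : e.functor.Braided := G.braided
  let : e.inverse.Monoidal := e.inverseMonoidal
  have : e.IsMonoidal := (inferInstance :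
    letI := e.toAdjunction.rightAdjointLaxMonoidal; e.toAdjunction.IsMonoidal)
  let : e.inverse.Braided :=
    { braided := fun X Y => by
        apply e.functor.map_injective
        rw [← cancel_mono (e.counit.app _), Functor.map_comp, Functor.map_comp, assoc, assoc,
          e.functor_map_μ_inverse_comp_counit_app_tensor]
        erw [e.counit.naturality (β_ X Y).hom]
        rw [e.functor_map_μ_inverse_comp_counit_app_tensor_assoc, Functor.map_braiding]
        simp }
  have : e.functor.Additive := G.additive
  have : e.functor.Linear k := G.linear
  have : e.inverse.Linear k := inferInstance
  have : e.inverse.Additive := inferInstance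
  let H : AUT k A :=
    { functor := e.inverse
      map_twist := fun X => by
        apply e.functor.map_injective
        have h := G.map_twist (e.inverse.obj X)
        have h' := θ_naturality (e.counit.app X)
        exact ((cancel_mono (e.counit.app X)).1
          ((e.counit.naturality (θ X)).trans h')).trans h.symm }
  exact ⟨H, isoMk (F := one k A) (G := comp G H) e.unitIso
    (inferInstanceAs (NatTrans.IsMonoidal e.unit)),
    isoMk (F := comp H G) (G := one k A) e.counitIso
    (inferInstanceAs (NatTrans.IsMonoidal e.counit)), fun X => e.functor_unit_comp X⟩

end AUT

end Cyclic

/-! ### Shifts by invertible objects, and why every structure is one. -/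

section Shift

variable {k : Type w} [Field k] {A : Type u} [Category.{v} A] [Preadditive A]
    [Linear k A] [MonoidalCategory A] [BraidedCategory A] [Balancing A]

/-- The shift of a ribbon Grothendieck–Verdier structure by an invertible object `L` of the
balanced Müger center: the dualizing object is `D L`, the duality functor is `D (L ⊗ -)`. -/
@[simps! K D]
def RibbonGVStructure.shift (R : RibbonGVStructure k A) (L : PIC (BalMugerCenter A)) :
    RibbonGVStructure k A where
  K := (R.D.obj L.of.obj.obj).unop
  D := tensorLeft L.of.obj.obj ⋙ R.D
  rep := R.shiftRep L.of.obj.obj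
  rep_comp := R.shiftRep_comp L.of.obj.obj
  rep_map := R.shiftRep_map L.of.obj.obj
  isEquivalence :=
    haveI := R.isEquivalence
    haveI := isEquivalence_tensorLeft (isInvertible_of_pic L)
    inferInstance
  dual_twist X := by
    change (R.D.map (L.of.obj.obj ◁ θ X)).unop = θ (R.D.obj (L.of.obj.obj ⊗ X)).unop
    -- Only the ribbon condition needs `L` to be balanced transparent; the rest of the shifted
    -- structure does not.
    rw [← (isBalTransparent_iff _).1 L.of.obj.property, R.dual_twist]

section

variable (R S : RibbonGVStructure k A) (G : AUT k A) (L : A)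
  (e : (R.D.obj L).unop ≅ G.functor.obj S.K)

/-- The comparison morphism `D_R (L ⊗ G X) ⟶ G (D_S X)` induced by `D_R L ≅ G K_S`. -/
def dualComparison (X : A) :
    (R.D.obj (L ⊗ G.functor.obj X)).unop ⟶ G.functor.obj (S.D.obj X).unop :=
  (R.shiftRep L _ _).symm (e.hom ≫ G.functor.map (S.rep X _ (𝟙 _)) ≫ δ G.functor _ _)

/-- The comparison corresponds to the identity of `D_S X`, so naturality in `Y` makes composition
with it realize the whole chain of hom-space identifications. -/
theorem shiftRep_dualComparison {X Y : A} (g : (S.D.obj X).unop ⟶ Y) :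
    R.shiftRep L _ _ (dualComparison R S G L e X ≫ G.functor.map g) =
      e.hom ≫ G.functor.map (S.rep X Y g) ≫ δ G.functor X Y := by
  rw [R.shiftRep_comp, dualComparison, LinearEquiv.apply_symm_apply]
  conv_rhs => rw [← id_comp g, S.rep_comp]
  simp

theorem dualComparison_naturality {X X' : A} (f : X ⟶ X') :
    (R.D.map (L ◁ G.functor.map f)).unop ≫ dualComparison R S G L e X =
      dualComparison R S G L e X' ≫ G.functor.map (S.D.map f).unop := by
  apply (R.shiftRep L _ _).injective
  rw [R.shiftRep_map, shiftRep_dualComparison, ← comp_id (S.D.map f).unop, S.rep_map,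
    dualComparison, LinearEquiv.apply_symm_apply]
  simp

/-- Yoneda on the image of `G`: by `shiftRep_dualComparison`, precomposition is a composite of
bijections. -/
instance (X : A) : IsIso (dualComparison R S G L e X) := by
  refine isIso_of_precomp_bijective G.functor _ fun Y => ?_
  have h1 : R.shiftRep L _ _ ∘ (fun w : G.functor.obj (S.D.obj X).unop ⟶ G.functor.obj Y =>
      dualComparison R S G L e X ≫ w) ∘ (G.functor.map (X := (S.D.obj X).unop) (Y := Y)) =
      (fun w => (e.hom ≫ w) ≫ δ G.functor X Y) ∘ (G.functor.map (X := S.K) (Y := X ⊗ Y)) ∘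
        S.rep X Y := by
    funext g
    simp only [Function.comp_apply, shiftRep_dualComparison, assoc]
  have hG {X Y : A} : Function.Bijective (G.functor.map (X := X) (Y := Y)) :=
    (Functor.FullyFaithful.ofFullyFaithful G.functor).map_bijective _ _
  rw [← Function.Bijective.of_comp_iff _ hG,
    ← Function.Bijective.of_comp_iff' (R.shiftRep L _ _).bijective]
  refine h1 ▸ Function.Bijective.comp ?_ (hG.comp (S.rep X Y).bijective)
  exact ⟨fun _ _ h => (cancel_epi e.hom).1 ((cancel_mono (δ G.functor X Y)).1 h), fun w => ⟨e.inv ≫ w ≫ Functor.LaxMonoidal.μ _ _ _,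
    by simp⟩⟩

/-- The natural isomorphism `G (D_S X) ≅ D_R (L ⊗ G X)`. -/
noncomputable def dualIso : S.D ⋙ G.functor.op ≅ G.functor ⋙ tensorLeft L ⋙ R.D :=
  NatIso.ofComponents (fun X => (asIso (dualComparison R S G L e X)).op) fun f =>
    Quiver.Hom.unop_inj (dualComparison_naturality R S G L e f).symm

include e

/-- In `G (D_S X) ≅ D_R (L ⊗ G X)` every functor other than `L ⊗ -` is an equivalence, hence so is
`L ⊗ -`. -/
theorem isInvertible_of_dualIso : isInvertible A L := by
  have := R.isEquivalence
  have := S.isEquivalence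
  have := Functor.isEquivalence_of_iso (dualIso R S G L e)
  have := Functor.isEquivalence_of_comp_left G.functor (tensorLeft L ⋙ R.D)
  exact isInvertible_of_isEquivalence (Functor.isEquivalence_of_comp_right (tensorLeft L) R.D)

/-- Through the comparison, both `D_R θ_{L ⊗ G X}` and `D_R (L ◁ θ_{G X})` become `θ` on `G (D_S
X)`, by the ribbon conditions of `R` and `S`; and `D_R` is faithful. -/
theorem isBalTransparent_of_dualIso : isBalTransparent A L := by
  rw [isBalTransparent_iff]
  have := R.isEquivalence
  have h (X : A) : θ (L ⊗ G.functor.obj X) = L ◁ θ (G.functor.obj X) := by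
    apply R.D.map_injective
    apply Quiver.Hom.unop_inj
    rw [R.dual_twist, ← cancel_mono (dualComparison R S G L e X), ← G.map_twist,
      dualComparison_naturality, S.dual_twist, G.map_twist, θ_naturality]
  intro Z
  -- Every object is isomorphic to some `G X`, and `θ` is natural.
  let i := G.functor.objObjPreimageIso Z
  rw [← cancel_epi (L ◁ i.hom), θ_naturality, h, ← MonoidalCategory.whiskerLeft_comp,
    ← MonoidalCategory.whiskerLeft_comp, θ_naturality]

end

/-- Every ribbon Grothendieck–Verdier structure is, up to transport along an autoequivalence, a
shift of a given one. -/
theorem exists_shift (R S : RibbonGVStructure k A) (G : AUT k A) :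
    ∃ L : PIC (BalMugerCenter A), Nonempty ((R.shift L).K ≅ G.functor.obj S.K) := by
  have := R.isEquivalence
  let e : (R.D.obj (R.D.objPreimage (op (G.functor.obj S.K)))).unop ≅ G.functor.obj S.K :=
    (R.D.objObjPreimageIso (op (G.functor.obj S.K))).symm.unop
  exact ⟨picMk _ (isInvertible_of_dualIso R S G _ e) (isBalTransparent_of_dualIso R S G _ e), ⟨e⟩⟩

end Shift

/-! ### The homotopy fiber and the Picard groupoid. -/

section Fiber

variable {k : Type w} [Field k] {A : Type u} [Category.{v} A] [Preadditive A]
    [Linear k A] [MonoidalCategory A] [BraidedCategory A] [Balancing A]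

namespace RibbonGVExtensions

/-- The autoequivalence underlying a ribbon Grothendieck–Verdier extension. -/
abbrev autPath (x : RibbonGVExtensions k A) : AUT k A := x.path

/-- The filler of a 1-morphism of ribbon Grothendieck–Verdier extensions. -/
abbrev autFill {x y : RibbonGVExtensions k A} (f : x ⟶ y) :
    f.map.φ ⊗ autPath y ≅ autPath x := f.fill

/-- The fillers are invertible, so they fix the image of a 2-morphism under the path of `y`, which
is faithful. -/
instance {x y : RibbonGVExtensions k A} (f g : x ⟶ y) : Subsingleton (f ⟶ g) where
  allEq a b := by
    have h (c : f ⟶ g) : RibbonGVStructure.Hom₂.cell c.cell ▷ autPath y ≫ (autFill g).hom = (autFill f).hom :=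
      c.comm
    refine HFiber.hom₂_ext (RibbonGVStructure.Hom₂.ext (AUT.hom_ext fun X => ?_))
    apply (autPath y).functor.map_injective
    have := (cancel_mono _).1 ((h a).trans (h b).symm)
    exact congrArg (fun c => (AUT.nat c).app X) this

/-- Isomorphisms of 1-morphisms of ribbon Grothendieck–Verdier extensions. -/
def isoMk {x y : RibbonGVExtensions k A} {f g : x ⟶ y} (e : f.map.φ ≅ g.map.φ)
    (h : f.map.kMap ≫ (AUT.nat e.hom).app x.pt.K = g.map.kMap)
    (h' : ∀ X, (autPath y).functor.map ((AUT.nat e.hom).app X) ≫ (AUT.nat (autFill g).hom).app X =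
      (AUT.nat (autFill f).hom).app X) : f ≅ g :=
  HFiber.isoMk (RibbonGVStructure.isoOfKMap e h) (AUT.hom_ext h')

/-- The extension given by the shift of a ribbon Grothendieck–Verdier structure. -/
def shift (R : RibbonGVStructure k A) (L : PIC (BalMugerCenter A)) : RibbonGVExtensions k A :=
  ⟨R.shift L, 𝟙_ (AUT k A)⟩

/-- 1-morphisms between shifts given by isomorphisms. -/
noncomputable def shiftMap (R : RibbonGVStructure k A) {L M : PIC (BalMugerCenter A)}
    (f : L ⟶ M) : shift R L ⟶ shift R M :=
  HFiber.Hom₁.mk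
    (RibbonGVStructure.Hom₁.ofIso (R := R.shift L) (S := R.shift M) (𝟙_ (AUT k A))
      ((R.D.mapIso ((isBalTransparent A).ι.mapIso ((isInvertible _).ι.mapIso f.iso))).unop))
    (λ_ (𝟙_ (AUT k A)))

theorem kMap_shiftMap (R : RibbonGVStructure k A) {L M : PIC (BalMugerCenter A)} (f : L ⟶ M) :
    (shiftMap R f).map.kMap = (R.D.map f.iso.hom.hom.hom).unop :=
  RibbonGVStructure.Hom₁.kMap_ofIso _ _

theorem autFill_shiftMap_app (R : RibbonGVStructure k A) {L M : PIC (BalMugerCenter A)}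
    (f : L ⟶ M) (X : A) : (AUT.nat (autFill (shiftMap R f)).hom).app X = 𝟙 X := rfl

theorem autFill_id_app (x : RibbonGVExtensions k A) (X : A) :
    (AUT.nat (autFill (𝟙 x)).hom).app X = 𝟙 _ := by
  change (autPath x).functor.map (𝟙 X) ≫ 𝟙 _ = 𝟙 _
  simp

theorem autFill_comp_app {x y z : RibbonGVExtensions k A} (f : x ⟶ y) (g : y ⟶ z) (X : A) :
    (AUT.nat (autFill (f ≫ g)).hom).app X =
      (AUT.nat (autFill g).hom).app (f.map.φ.functor.obj X) ≫
        (AUT.nat (autFill f).hom).app X := by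
  change (autPath z).functor.map (𝟙 _) ≫ 𝟙 _ ≫ _ ≫ _ = _
  rw [CategoryTheory.Functor.map_id]
  exact (id_comp _).trans (id_comp _)

theorem kMap_id (x : RibbonGVExtensions k A) :
    RibbonGVStructure.Hom₁.kMap (𝟙 x : x ⟶ x).map = 𝟙 x.pt.K :=
  RibbonGVStructure.Hom₁.kMap_id _

theorem kMap_comp {x y z : RibbonGVExtensions k A} (f : x ⟶ y) (g : y ⟶ z) :
    RibbonGVStructure.Hom₁.kMap (f ≫ g).map =
      g.map.kMap ≫ g.map.φ.functor.map f.map.kMap :=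
  RibbonGVStructure.Hom₁.kMap_comp _ _

/-- The pseudofunctor from the Picard groupoid to the ribbon Grothendieck–Verdier extensions. -/
noncomputable def picToExtensions (R : RibbonGVStructure k A) :
    Pseudofunctor (LocallyDiscrete (PIC (BalMugerCenter A))) (RibbonGVExtensions k A) :=
  LocallyDiscrete.mkPseudofunctor (shift R) (shiftMap R)
    (fun L => isoMk (Iso.refl (𝟙_ (AUT k A)))
      (by
        rw [kMap_id, kMap_shiftMap]
        exact (comp_id _).trans (congrArg Quiver.Hom.unop (R.D.map_id _)))
      (fun X => by
        rw [autFill_id_app, autFill_shiftMap_app]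
        exact id_comp _))
    (fun f g => isoMk (λ_ (𝟙_ (AUT k A))).symm
      (by
        rw [kMap_comp, kMap_shiftMap, kMap_shiftMap, kMap_shiftMap]
        exact (comp_id _).trans (congrArg Quiver.Hom.unop (R.D.map_comp _ _)))
      (fun X => by
        rw [autFill_comp_app, autFill_shiftMap_app, autFill_shiftMap_app, autFill_shiftMap_app]
        exact (id_comp _).trans (id_comp _)))
    -- All coherence laws hold because parallel 2-morphisms agree.
    (fun _ _ _ => Subsingleton.elim _ _) (fun _ => Subsingleton.elim _ _)
    (fun _ => Subsingleton.elim _ _)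

/-- Both fillers are trivial, so the 2-morphism is the identity transformation; then the two maps of
dualizing objects coincide, and `D` is faithful. -/
theorem shiftMap_injective (R : RibbonGVStructure k A) {L M : PIC (BalMugerCenter A)}
    {f g : L ⟶ M} (a : shiftMap R f ⟶ shiftMap R g) : f = g := by
  have := R.isEquivalence
  have h1 := RibbonGVStructure.kMap_comm a.cell
  have h2 : AUT.nat (RibbonGVStructure.Hom₂.cell a.cell) = 𝟙 _ := by
    ext X
    have := congrArg (fun c => (AUT.nat c).app X) a.comm
    exact (comp_id _).symm.trans this
  rw [h2, kMap_shiftMap, kMap_shiftMap] at h1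
  have h3 := R.D.map_injective (Quiver.Hom.unop_inj ((comp_id _).symm.trans h1))
  exact Core.hom_ext (ObjectProperty.hom_ext _ (ObjectProperty.hom_ext _ h3))

/-- The filler trivializes the autoequivalence of `h`; what remains of `h` is an isomorphism `D M ≅
D L`, which lifts along the fully faithful `D`. -/
theorem exists_iso_shiftMap (R : RibbonGVStructure k A) {L M : PIC (BalMugerCenter A)}
    (h : shift R L ⟶ shift R M) : ∃ f : L ⟶ M, Nonempty (shiftMap R f ≅ h) := by
  have := R.isEquivalence
  let e : h.map.φ ≅ 𝟙_ (AUT k A) := (ρ_ h.map.φ).symm ≪≫ autFill h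
  let i : (R.D.obj M.of.obj.obj).unop ≅ (R.D.obj L.of.obj.obj).unop :=
    @asIso _ _ _ _ h.map.kMap (RibbonGVStructure.Hom₁.isIso_kMap _) ≪≫ (asIso (AUT.nat e.hom)).app _
  refine ⟨⟨(isInvertible _).isoMk ((isBalTransparent A).isoMk (R.D.preimageIso i.op))⟩,
    ⟨(isoMk e ?_ fun X => ?_).symm⟩⟩
  · rw [kMap_shiftMap]
    exact (congrArg Quiver.Hom.unop (R.D.map_preimage i.hom.op)).symm
  · rw [autFill_shiftMap_app]
    exact (comp_id _).trans (id_comp _)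

theorem exists_equivalence_shift (R : RibbonGVStructure k A) (x : RibbonGVExtensions k A) :
    ∃ L : PIC (BalMugerCenter A), Nonempty (Bicategory.Equivalence (shift R L) x) := by
  obtain ⟨L, ⟨e⟩⟩ := exists_shift R x.pt (autPath x)
  obtain ⟨H, η, ε, h⟩ := (autPath x).exists_inverse
  let u : x.pt.K ≅ H.functor.obj ((autPath x).functor.obj x.pt.K) :=
    (asIso (AUT.nat η.hom)).app x.pt.K
  let c (Y : A) : (autPath x).functor.obj (H.functor.obj Y) ⟶ Y := (AUT.nat ε.hom).app Y
  have hu : (autPath x).functor.map u.hom ≫ c _ = 𝟙 _ := h _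
  let i : x.pt.K ≅ H.functor.obj (R.shift L).K := u ≪≫ H.functor.mapIso e.symm
  let f : shift R L ⟶ x := HFiber.Hom₁.mk
    (RibbonGVStructure.Hom₁.ofIso (R := R.shift L) (S := x.pt) H i) ε
  let g : x ⟶ shift R L := HFiber.Hom₁.mk
    (RibbonGVStructure.Hom₁.ofIso (R := x.pt) (S := R.shift L) (autPath x) e)
    (ρ_ (autPath x))
  have hf : f.map.kMap = i.hom := RibbonGVStructure.Hom₁.kMap_ofIso _ _
  have hg : g.map.kMap = e.hom := RibbonGVStructure.Hom₁.kMap_ofIso _ _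
  -- The counit and unit of the inverse `H` serve as the invertible 2-morphisms. The triangle
  -- identity gives the dualizing-object condition for `ε` (via `hu`) and the filler condition for
  -- `η`.
  refine ⟨L, ⟨Bicategory.Equivalence.mkOfAdjointifyCounit (f := f) (g := g)
    (isoMk (f := f ≫ g) (g := 𝟙 _) ε ?_ fun X => ?_).symm
    (isoMk (f := 𝟙 x) (g := g ≫ f) η ?_ fun X => ?_).symm⟩⟩
  · rw [kMap_comp, kMap_id, hf, hg]
    have hc : (autPath x).functor.map (H.functor.map e.inv) ≫ c _ = c _ ≫ e.inv :=
      (AUT.nat ε.hom).naturality e.inv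
    have hi : e.hom ≫ (autPath x).functor.map i.hom ≫ c _ = 𝟙 _ := by
      simp [i, hc, reassoc_of% hu]
    exact (assoc _ _ _).trans hi
  · rw [autFill_comp_app, autFill_id_app]
    exact (comp_id _).trans (id_comp _).symm
  · rw [kMap_comp, kMap_id, hf, hg]
    have hi : u.hom = i.hom ≫ H.functor.map e.hom := by simp [i]
    exact (id_comp _).trans hi
  · rw [autFill_comp_app, autFill_id_app]
    exact (congrArg (_ ≫ ·) (comp_id _)).trans (h X)

/-- The ribbon Grothendieck–Verdier extensions are classified by the Picard groupoid of the
balanced Müger center. -/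
theorem isBiequivalence_picToExtensions (R : RibbonGVStructure k A) :
    IsBiequivalence (picToExtensions R) where
  locally_equivalence _ _ :=
    { faithful := ⟨fun _ => Subsingleton.elim _ _⟩
      full := ⟨fun c =>
        ⟨eqToHom (Discrete.ext (shiftMap_injective R c)), Subsingleton.elim _ _⟩⟩
      essSurj := ⟨fun h => (exists_iso_shiftMap R h).imp' Discrete.mk fun _ => id⟩ }
  essentially_surjective x := (exists_equivalence_shift R x).imp' LocallyDiscrete.mk fun _ => id

end RibbonGVExtensions

end Fiber

end RibGV

open CategoryTheory RibGV in
theorem corollary4p3 (k : Type w) [Field k] [IsAlgClosed k]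
    (A : Type u) [Category.{v} A] [Abelian A] [Linear k A] [FiniteLinearCategory k A]
    [MonoidalCategory A] [MonoidalPreadditive A] [MonoidalLinear k A] [LeftExactTensor A]
    [BraidedCategory A] [Balancing A] :
    IsEmpty (RibbonGVExtensions k A) ∨
      ∃ F : Pseudofunctor (LocallyDiscrete (PIC (BalMugerCenter A))) (RibbonGVExtensions k A),
        IsBiequivalence F := by
  rcases isEmpty_or_nonempty (RibbonGVExtensions k A) with h | ⟨⟨x⟩⟩
  · exact Or.inl h
  -- Any point of the fiber supplies a base structure; its path to the base point plays no role.
  · exact Or.inr ⟨_, RibbonGVExtensions.isBiequivalence_picToExtensions x.pt⟩
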